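/- Let $G$ be a finite group and $\omega\colon G^3\to\mathbb C^\times$ a three-cocycle. Write $p\triangleright h=php^{-1}$, $C_G(g)$ for the centralizer of $g$, and $\overline g$ for the conjugacy class of $g$. Let $\mathrm{Vect}_G^\omega$ be the category of finite-dimensional $G$-graded complex vector spaces with associativity constraint $(u\otimes v)\otimes w\mapsto\omega(|u|,|v|,|w|)\,u\otimes(v\otimes w)$, and let $\mathcal Z(\mathrm{Vect}_G^\omega)$ be its (right) Drinfeld center, whose objects are pairs $(W,\sigma_{\cdot,W})$ with half-braidings $\sigma_{V,W}\colon V\otimes W\to W\otimes V$. Such a half-braiding has the form $\sigma_{V,W}(v\otimes w)=(|v|\triangleright w)\otimes v$ for a map $G\times W\to W$, $(x,w)\mapsto x\triangleright w$, linear in $w$ and satisfying $|x\triangleright w|=x\triangleright|w|$ and $x\triangleright(y\triangleright w)=\alpha_{|w|}(x,y)\,(xy)\triangleright w$, where $$\alpha_g(x,y)=\omega(x,y,g)^{-1}\,\omega(x,y\triangleright g,y)\,\omega(xy\triangleright g,x,y)^{-1}.$$ For an object $V$ of the center and $x\in G$ let $\chi_V^{(x)}\colon C_G(x)\to\mathbb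 C$, $c\mapsto\operatorname{tr}(c\,\triangleright\colon V_x\to V_x)$, be the $\alpha_x$-projective character of $C_G(x)$ on the homogeneous component $V_x$. A simple object $V$ is said to correspond to $(g,\chi)$ if $V_g\neq0$ and $\chi=\chi_V^{(g)}$. For objects $V,W$ of the center put $S_{V,W}=\operatorname{tr}(\sigma_{W,V}\sigma_{V,W})$, the trace of the linear endomorphism $\sigma_{W,V}\sigma_{V,W}$ of $V\otimes W$. Let $V$ and $W$ be simple objects of $\mathcal Z(\mathrm{Vect}_G^\omega)$ corresponding to $(g,\chi_1)$ and $(h,\chi_2)$. Then the double-sum formula $$S_{V,W}=\sum_{\substack{x\in\overline g,\;y\in\overline h\\ [x,y]=1}}\chi_V^{(x)}(y)\,\chi_W^{(y)}(x)$$ holds, and it can be replaced by a single sum: $$S_{V,W}=|\overline h|\sum_{\substack{p\in G/C_G(g)\\ [p\triangleright g,h]=1}}\alpha_g(h,p)\,\alpha_g^{-1}(p,p^{-1}\triangleright h)\,\chi_1(p^{-1}\triangleright h)\,\chi_2(p\triangleright g),$$ where $p$ runs through an arbitrary set of representatives of the left cosets of $C_G(g)$ in $G$. Equivalently, the sum may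 be taken over the $x\in\overline g$ with $[x,h]=1$, where $p$ denotes, for each $x$, an arbitrary element with $p\triangleright g=x$; or $$S_{V,W}=\frac{|\overline h|}{|C_G(g)|}\sum_{\substack{p\in G\\ [p\triangleright g,h]=1}}\alpha_g(h,p)\,\alpha_g^{-1}(p,p^{-1}\triangleright h)\,\chi_1(p^{-1}\triangleright h)\,\chi_2(p\triangleright g).$$ -/

import Mathlib

open CategoryTheory MonoidalCategory TensorProduct

noncomputable section

/-- A three-cocycle of `G` with values in the trivial `G`-module `ℂˣ`. -/
structure ThreeCocycle (G : Type*) [Group G] where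
  toFun : G → G → G → ℂˣ
  cocycle : ∀ a b c d : G,
    toFun b c d * toFun a (b * c) d * toFun a b c = toFun (a * b) c d * toFun a b (c * d)

instance {G : Type*} [Group G] : CoeFun (ThreeCocycle G) (fun _ => G → G → G → ℂˣ) :=
  ⟨ThreeCocycle.toFun⟩

/-- Objects of `Vect_G^ω`: finite-dimensional complex vector spaces with a `G`-grading. The grading
`V = ⨁ V_x` is given by its homogeneous projections `proj x : V → V_x ⊆ V`, a complete family of
orthogonal idempotents. -/
structure VectG {G : Type*} [Group G] [Fintype G] (ω : ThreeCocycle G) where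
  carrier : Type
  [addCommGroup : AddCommGroup carrier]
  [module : Module ℂ carrier]
  [finite : FiniteDimensional ℂ carrier]
  proj : G → carrier →ₗ[ℂ] carrier
  proj_same : ∀ x v, proj x (proj x v) = proj x v
  proj_ne : ∀ x y v, x ≠ y → proj x (proj y v) = 0
  sum_proj : ∀ v, ∑ x, proj x v = v

namespace VectG

variable {G : Type*} [Group G] [Fintype G] {ω : ThreeCocycle G}

instance : CoeSort (VectG ω) Type := ⟨VectG.carrier⟩

instance (V : VectG ω) : AddCommGroup V := V.addCommGroup
instance (V : VectG ω) : Module ℂ V := V.module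
instance (V : VectG ω) : FiniteDimensional ℂ V := V.finite

/-- The homogeneous component `V_x`. -/
def component (V : VectG ω) (x : G) : Submodule ℂ V := LinearMap.range (V.proj x)

theorem mem_component {V : VectG ω} {x : G} {v : V} : v ∈ V.component x ↔ V.proj x v = v := by
  constructor
  · rintro ⟨w, rfl⟩
    exact V.proj_same x w
  · intro h
    exact ⟨v, h⟩

theorem proj_mem (V : VectG ω) (x : G) (v : V) : V.proj x v ∈ V.component x := ⟨v, rfl⟩

theorem proj_of_mem_ne {V : VectG ω} {x y : G} {v : V} (hv : v ∈ V.component y) (h : x ≠ y) :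
    V.proj x v = 0 := by
  rw [← mem_component.1 hv, V.proj_ne x y v h]

theorem hext2 {M : Type*} [AddCommGroup M] [Module ℂ M] {V W : VectG ω}
    {f g : (V ⊗[ℂ] W) →ₗ[ℂ] M}
    (H : ∀ x y, ∀ v ∈ V.component x, ∀ w ∈ W.component y, f (v ⊗ₜ w) = g (v ⊗ₜ w)) : f = g := by
  refine TensorProduct.ext' fun v w => ?_
  rw [← V.sum_proj v, ← W.sum_proj w]
  simp only [TensorProduct.sum_tmul, TensorProduct.tmul_sum, map_sum]
  exact Finset.sum_congr rfl fun i _ => Finset.sum_congr rfl fun j _ =>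
    H _ _ _ (V.proj_mem _ _) _ (W.proj_mem _ _)

theorem hext3 {M : Type*} [AddCommGroup M] [Module ℂ M] {U V W : VectG ω}
    {f g : ((U ⊗[ℂ] V) ⊗[ℂ] W) →ₗ[ℂ] M}
    (H : ∀ x y z, ∀ u ∈ U.component x, ∀ v ∈ V.component y, ∀ w ∈ W.component z,
      f ((u ⊗ₜ v) ⊗ₜ w) = g ((u ⊗ₜ v) ⊗ₜ w)) : f = g := by
  refine TensorProduct.ext_threefold fun u v w => ?_
  rw [← U.sum_proj u, ← V.sum_proj v, ← W.sum_proj w]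
  simp only [TensorProduct.sum_tmul, TensorProduct.tmul_sum, map_sum]
  exact Finset.sum_congr rfl fun i _ => Finset.sum_congr rfl fun j _ => Finset.sum_congr rfl
    fun k _ => H _ _ _ _ (U.proj_mem _ _) _ (V.proj_mem _ _) _ (W.proj_mem _ _)

theorem hext3' {M : Type*} [AddCommGroup M] [Module ℂ M] {U V W : VectG ω}
    {f g : (U ⊗[ℂ] (V ⊗[ℂ] W)) →ₗ[ℂ] M}
    (H : ∀ x y z, ∀ u ∈ U.component x, ∀ v ∈ V.component y, ∀ w ∈ W.component z,
      f (u ⊗ₜ (v ⊗ₜ w)) = g (u ⊗ₜ (v ⊗ₜ w))) : f = g := by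
  have h : f ∘ₗ (TensorProduct.assoc ℂ U V W).toLinearMap
      = g ∘ₗ (TensorProduct.assoc ℂ U V W).toLinearMap :=
    hext3 fun x y z u hu v hv w hw => by simpa using H x y z u hu v hv w hw
  ext1
  ext u : 1
  ext v w
  simpa using LinearMap.congr_fun h ((u ⊗ₜ v) ⊗ₜ w)

theorem hext4 {M : Type*} [AddCommGroup M] [Module ℂ M] {T U V W : VectG ω}
    {f g : (((T ⊗[ℂ] U) ⊗[ℂ] V) ⊗[ℂ] W) →ₗ[ℂ] M}
    (H : ∀ a x y z, ∀ t ∈ T.component a, ∀ u ∈ U.component x, ∀ v ∈ V.component y,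
      ∀ w ∈ W.component z,
      f (((t ⊗ₜ u) ⊗ₜ v) ⊗ₜ w) = g (((t ⊗ₜ u) ⊗ₜ v) ⊗ₜ w)) : f = g := by
  refine TensorProduct.ext_fourfold fun t u v w => ?_
  rw [← T.sum_proj t, ← U.sum_proj u, ← V.sum_proj v, ← W.sum_proj w]
  simp only [TensorProduct.sum_tmul, TensorProduct.tmul_sum, map_sum]
  exact Finset.sum_congr rfl fun i _ => Finset.sum_congr rfl fun j _ => Finset.sum_congr rfl
    fun k _ => Finset.sum_congr rfl fun l _ => H _ _ _ _ _ (T.proj_mem _ _) _ (U.proj_mem _ _) _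
      (V.proj_mem _ _) _ (W.proj_mem _ _)

/-- Morphisms of `Vect_G^ω`: linear maps preserving the grading. -/
@[ext]
structure Hom (V W : VectG ω) where
  lin : V →ₗ[ℂ] W
  comm : ∀ x v, lin (V.proj x v) = W.proj x (lin v)

instance : Category (VectG ω) where
  Hom := Hom
  id V := ⟨LinearMap.id, fun _ _ => rfl⟩
  comp f g := ⟨g.lin ∘ₗ f.lin, fun x v => by simp [f.comm, g.comm]⟩

@[ext]
theorem hom_ext {V W : VectG ω} {f g : V ⟶ W} (h : f.lin = g.lin) : f = g := Hom.ext h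

@[simp] theorem id_lin (V : VectG ω) : (𝟙 V : V ⟶ V).lin = LinearMap.id := rfl

@[simp] theorem comp_lin {U V W : VectG ω} (f : U ⟶ V) (g : V ⟶ W) :
    (f ≫ g).lin = g.lin ∘ₗ f.lin := rfl

theorem lin_mem {V W : VectG ω} (f : V ⟶ W) {x : G} {v : V} (hv : v ∈ V.component x) :
    f.lin v ∈ W.component x := by
  rw [mem_component] at hv ⊢
  rw [← f.comm, hv]

/-- A linear map sending each `V_x` to `W_x` is a morphism. -/
def homMk {V W : VectG ω} (f : V →ₗ[ℂ] W)
    (h : ∀ x, ∀ v ∈ V.component x, f v ∈ W.component x) : V ⟶ W where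
  lin := f
  comm x v := by
    conv_rhs => rw [← V.sum_proj v]
    rw [map_sum, map_sum, Finset.sum_eq_single x]
    · exact (mem_component.1 (h x _ (V.proj_mem x v))).symm
    · intro y _ hy
      exact proj_of_mem_ne (h y _ (V.proj_mem y v)) hy.symm
    · simp

@[simp] theorem homMk_lin {V W : VectG ω} (f : V →ₗ[ℂ] W)
    (h : ∀ x, ∀ v ∈ V.component x, f v ∈ W.component x) : (homMk f h).lin = f := rfl

instance : Limits.HasZeroMorphisms (VectG ω) where
  zero V W := ⟨⟨0, fun _ _ => by simp⟩⟩
  comp_zero f W := by ext v; rfl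
  zero_comp V _ _ g := by ext v; exact map_zero g.lin

@[simp] theorem zero_lin (V W : VectG ω) : (0 : V ⟶ W).lin = 0 := rfl

/-- An isomorphism from a pair of mutually inverse linear maps, the first of which is graded. -/
def isoMk {V W : VectG ω} (f : V →ₗ[ℂ] W) (g : W →ₗ[ℂ] V)
    (h : ∀ x, ∀ v ∈ V.component x, f v ∈ W.component x)
    (hgf : g ∘ₗ f = LinearMap.id) (hfg : f ∘ₗ g = LinearMap.id) : V ≅ W where
  hom := homMk f h
  inv := ⟨g, fun x w => by
    have h1 := (homMk f h).comm x (g w)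
    have h2 : f (g w) = w := LinearMap.congr_fun hfg w
    simp only [homMk_lin, h2] at h1
    rw [← h1]
    exact (LinearMap.congr_fun hgf _).symm ▸ rfl⟩
  hom_inv_id := hom_ext hgf
  inv_hom_id := hom_ext hfg

section tensor

/-- The tensor product, graded by `(V ⊗ W)_x = ⨁_y V_y ⊗ W_{y⁻¹x}`. -/
abbrev tensor (V W : VectG ω) : VectG ω where
  carrier := V ⊗[ℂ] W
  proj x := ∑ y, TensorProduct.map (V.proj y) (W.proj (y⁻¹ * x))
  proj_same x t := by
    induction t with
    | zero => simp
    | add a b ha hb => simp only [map_add, ha, hb]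
    | tmul v w =>
      simp only [LinearMap.sum_apply, TensorProduct.map_tmul, map_sum]
      refine Finset.sum_congr rfl fun y _ => ?_
      rw [Finset.sum_eq_single y]
      · rw [V.proj_same, W.proj_same]
      · intro z _ hz
        rw [V.proj_ne _ _ _ hz, TensorProduct.zero_tmul]
      · simp
  proj_ne x x' t hx := by
    induction t with
    | zero => simp
    | add a b ha hb => simp only [map_add, ha, hb, add_zero]
    | tmul v w =>
      simp only [LinearMap.sum_apply, TensorProduct.map_tmul, map_sum]
      refine Finset.sum_eq_zero fun y _ => Finset.sum_eq_zero fun z _ => ?_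
      by_cases hz : z = y
      · subst hz
        rw [W.proj_ne _ _ _ (fun h => hx (mul_left_cancel h)), TensorProduct.tmul_zero]
      · rw [V.proj_ne _ _ _ hz, TensorProduct.zero_tmul]
  sum_proj t := by
    induction t with
    | zero => simp
    | add a b ha hb => simp only [map_add, Finset.sum_add_distrib, ha, hb]
    | tmul v w =>
      simp only [LinearMap.sum_apply, TensorProduct.map_tmul]
      rw [Finset.sum_comm]
      have : ∀ y, ∑ x, V.proj y v ⊗ₜ[ℂ] W.proj (y⁻¹ * x) w = V.proj y v ⊗ₜ[ℂ] w := by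
        intro y
        rw [← TensorProduct.tmul_sum]
        congr 1
        conv_rhs => rw [← W.sum_proj w]
        exact Fintype.sum_equiv (Equiv.mulLeft y⁻¹) _ _ (fun _ => rfl)
      simp only [this]
      rw [← TensorProduct.sum_tmul, V.sum_proj]

theorem tmul_mem {V W : VectG ω} {x y : G} {v : V} {w : W}
    (hv : v ∈ V.component x) (hw : w ∈ W.component y) :
    (v ⊗ₜ[ℂ] w : V ⊗[ℂ] W) ∈ (tensor V W).component (x * y) := by
  rw [mem_component]
  change (∑ z, TensorProduct.map (V.proj z) (W.proj (z⁻¹ * (x * y)))) (v ⊗ₜ[ℂ] w) = _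
  simp only [LinearMap.sum_apply, TensorProduct.map_tmul]
  rw [Finset.sum_eq_single x]
  · rw [inv_mul_cancel_left, mem_component.1 hv, mem_component.1 hw]
  · intro z _ hz
    rw [proj_of_mem_ne hv hz, TensorProduct.zero_tmul]
  · simp

/-- The product of two homogeneous components spans: a linear map out of `V ⊗ W` is graded as soon
as it sends `V_x ⊗ W_y` to degree `xy`. -/
theorem graded_of_tmul {V W X : VectG ω} (f : (V ⊗[ℂ] W) →ₗ[ℂ] X)
    (h : ∀ x y, ∀ v ∈ V.component x, ∀ w ∈ W.component y, f (v ⊗ₜ w) ∈ X.component (x * y)) :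
    ∀ x, ∀ t ∈ (tensor V W).component x, f t ∈ X.component x := by
  intro x t ht
  rw [mem_component] at ht ⊢
  have key : f ∘ₗ (tensor V W).proj x = X.proj x ∘ₗ f := by
    refine hext2 fun a b v hv w hw => ?_
    have h1 := tmul_mem hv hw
    have h2 := h a b v hv w hw
    simp only [LinearMap.comp_apply]
    by_cases hx : x = a * b
    · subst hx
      rw [mem_component.1 h1, mem_component.1 h2]
    · rw [proj_of_mem_ne h1 hx, proj_of_mem_ne h2 hx, map_zero]
  have := LinearMap.congr_fun key t
  simp only [LinearMap.comp_apply] at this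
  rw [← this, ht]

/-- The tensor product of morphisms. -/
def tensorMap {V V' W W' : VectG ω} (f : V ⟶ V') (g : W ⟶ W') : tensor V W ⟶ tensor V' W' :=
  homMk (TensorProduct.map f.lin g.lin)
    (graded_of_tmul (X := tensor V' W') _ fun _ _ _ hv _ hw => tmul_mem (lin_mem f hv) (lin_mem g hw))

variable [DecidableEq G]

/-- The line `ℂ` in degree `x`. -/
abbrev line (x : G) : VectG ω where
  carrier := ℂ
  proj y := if y = x then LinearMap.id else 0
  proj_same y v := by split_ifs <;> rfl
  proj_ne y z v h := by
    by_cases hy : y = x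
    · have : z ≠ x := fun hz => h (hy.trans hz.symm)
      simp [this]
    · simp [hy]
  sum_proj v := by
    rw [Finset.sum_eq_single x] <;> simp +contextual

theorem mem_line (x : G) (c : ℂ) : (c : line (ω := ω) x) ∈ (line (ω := ω) x).component x := by
  rw [mem_component]
  change (if x = x then LinearMap.id else (0 : ℂ →ₗ[ℂ] ℂ)) c = c
  simp

theorem mem_line_ne {x y : G} {c : line (ω := ω) x} (hc : c ∈ (line (ω := ω) x).component y)
    (h : y ≠ x) : c = 0 := by
  rw [mem_component] at hc
  rw [← hc]
  change (if y = x then LinearMap.id else (0 : ℂ →ₗ[ℂ] ℂ)) c = 0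
  simp [h]


end tensor

section associator

/-- The linear automorphism acting on `V_x` by the scalar `φ x`. -/
def diag (φ : G → ℂˣ) (V : VectG ω) : V →ₗ[ℂ] V := ∑ x, (φ x : ℂ) • V.proj x

theorem diag_apply (φ : G → ℂˣ) {V : VectG ω} {x : G} {v : V} (hv : v ∈ V.component x) :
    diag φ V v = (φ x : ℂ) • v := by
  simp only [diag, LinearMap.sum_apply, LinearMap.smul_apply]
  rw [Finset.sum_eq_single x]
  · rw [mem_component.1 hv]
  · intro z _ hz
    rw [proj_of_mem_ne hv hz, smul_zero]
  · simp

theorem hext1 {M : Type*} [AddCommGroup M] [Module ℂ M] {V : VectG ω} {f g : V →ₗ[ℂ] M}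
    (H : ∀ x, ∀ v ∈ V.component x, f v = g v) : f = g := by
  ext v
  rw [← V.sum_proj v, map_sum, map_sum]
  exact Finset.sum_congr rfl fun i _ => H _ _ (V.proj_mem _ _)

/-- The linear endomorphism acting on `(U_x ⊗ V_y) ⊗ W_z` by the scalar `φ x y z`. -/
def diag3 (φ : G → G → G → ℂˣ) (U V W : VectG ω) :
    ((U ⊗[ℂ] V) ⊗[ℂ] W) →ₗ[ℂ] ((U ⊗[ℂ] V) ⊗[ℂ] W) :=
  ∑ x, ∑ y, ∑ z, (φ x y z : ℂ) •
    TensorProduct.map (TensorProduct.map (U.proj x) (V.proj y)) (W.proj z)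

theorem diag3_apply (φ : G → G → G → ℂˣ) {U V W : VectG ω} {x y z : G} {u : U} {v : V} {w : W}
    (hu : u ∈ U.component x) (hv : v ∈ V.component y) (hw : w ∈ W.component z) :
    diag3 φ U V W ((u ⊗ₜ v) ⊗ₜ w) = (φ x y z : ℂ) • ((u ⊗ₜ v) ⊗ₜ w) := by
  simp only [diag3, LinearMap.sum_apply, LinearMap.smul_apply, TensorProduct.map_tmul]
  rw [Finset.sum_eq_single x, Finset.sum_eq_single y, Finset.sum_eq_single z]
  · rw [mem_component.1 hu, mem_component.1 hv, mem_component.1 hw]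
  · intro a _ ha
    rw [proj_of_mem_ne hw ha]; simp
  · simp
  · intro a _ ha
    rw [proj_of_mem_ne hv ha]; simp
  · simp
  · intro a _ ha
    rw [proj_of_mem_ne hu ha]; simp
  · simp

/-- `(u ⊗ v) ⊗ w ↦ ω(|u|,|v|,|w|) u ⊗ (v ⊗ w)` as a linear map. -/
def assocLin (U V W : VectG ω) : ((U ⊗[ℂ] V) ⊗[ℂ] W) →ₗ[ℂ] (U ⊗[ℂ] (V ⊗[ℂ] W)) :=
  (TensorProduct.assoc ℂ U V W).toLinearMap ∘ₗ diag3 ω U V W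

theorem assocLin_apply {U V W : VectG ω} {x y z : G} {u : U} {v : V} {w : W}
    (hu : u ∈ U.component x) (hv : v ∈ V.component y) (hw : w ∈ W.component z) :
    assocLin U V W ((u ⊗ₜ v) ⊗ₜ w) = (ω x y z : ℂ) • (u ⊗ₜ (v ⊗ₜ w)) := by
  simp [assocLin, diag3_apply ω hu hv hw]

/-- The inverse of `assocLin`. -/
def assocInvLin (U V W : VectG ω) : (U ⊗[ℂ] (V ⊗[ℂ] W)) →ₗ[ℂ] ((U ⊗[ℂ] V) ⊗[ℂ] W) :=
  diag3 (fun x y z => (ω x y z)⁻¹) U V W ∘ₗ (TensorProduct.assoc ℂ U V W).symm.toLinearMap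

theorem assocInvLin_apply {U V W : VectG ω} {x y z : G} {u : U} {v : V} {w : W}
    (hu : u ∈ U.component x) (hv : v ∈ V.component y) (hw : w ∈ W.component z) :
    assocInvLin U V W (u ⊗ₜ (v ⊗ₜ w)) = ((ω x y z)⁻¹ : ℂ) • ((u ⊗ₜ v) ⊗ₜ w) := by
  simp [assocInvLin, diag3_apply (fun x y z => (ω x y z)⁻¹) hu hv hw]

theorem graded_of_tmul3 {U V W X : VectG ω} (f : ((U ⊗[ℂ] V) ⊗[ℂ] W) →ₗ[ℂ] X)
    (h : ∀ x y z, ∀ u ∈ U.component x, ∀ v ∈ V.component y, ∀ w ∈ W.component z,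
      f ((u ⊗ₜ v) ⊗ₜ w) ∈ X.component (x * y * z)) :
    ∀ x, ∀ t ∈ (tensor (tensor U V) W).component x, f t ∈ X.component x := by
  intro x t ht
  rw [mem_component] at ht ⊢
  have key : f ∘ₗ (tensor (tensor U V) W).proj x = X.proj x ∘ₗ f := by
    refine hext3 fun a b c u hu v hv w hw => ?_
    have h1 := tmul_mem (V := tensor U V) (tmul_mem hu hv) hw
    have h2 := h a b c u hu v hv w hw
    simp only [LinearMap.comp_apply]
    by_cases hx : x = a * b * c
    · subst hx
      rw [mem_component.1 h1, mem_component.1 h2]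
    · rw [proj_of_mem_ne h1 hx, proj_of_mem_ne h2 hx, map_zero]
  have := LinearMap.congr_fun key t
  simp only [LinearMap.comp_apply] at this
  rw [← this, ht]

/-- The associativity constraint `(u ⊗ v) ⊗ w ↦ ω(|u|,|v|,|w|) u ⊗ (v ⊗ w)`. -/
def assocIso (U V W : VectG ω) : tensor (tensor U V) W ≅ tensor U (tensor V W) :=
  isoMk (assocLin U V W) (assocInvLin U V W)
    (graded_of_tmul3 (X := tensor U (tensor V W)) _ fun x y z u hu v hv w hw => by
      rw [assocLin_apply hu hv hw, mul_assoc]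
      exact Submodule.smul_mem _ _ (tmul_mem (W := tensor V W) hu (tmul_mem hv hw)))
    (hext3 fun x y z u hu v hv w hw => by
      simp [assocLin_apply hu hv hw, assocInvLin_apply hu hv hw])
    (hext3' fun x y z u hu v hv w hw => by
      simp [assocLin_apply hu hv hw, assocInvLin_apply hu hv hw])

theorem diag_comp_inv (φ : G → ℂˣ) (V : VectG ω) :
    diag φ V ∘ₗ diag (fun x => (φ x)⁻¹) V = LinearMap.id :=
  hext1 fun x v hv => by
    simp [diag_apply _ hv]

theorem diag_inv_comp (φ : G → ℂˣ) (V : VectG ω) :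
    diag (fun x => (φ x)⁻¹) V ∘ₗ diag φ V = LinearMap.id :=
  hext1 fun x v hv => by
    simp [diag_apply _ hv]

theorem diag_natural (φ : G → ℂˣ) {V W : VectG ω} (f : V ⟶ W) :
    diag φ W ∘ₗ f.lin = f.lin ∘ₗ diag φ V :=
  hext1 fun x v hv => by
    simp [diag_apply _ hv, diag_apply _ (lin_mem f hv)]

variable [DecidableEq G]

/-- The left unit constraint `1 ⊗ v ↦ ω(1,1,|v|)⁻¹ v` (just `1 ⊗ v ↦ v` if `ω` is normalized). -/
def leftUnitIso (V : VectG ω) : tensor (line 1) V ≅ V :=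
  isoMk (V := tensor (line 1) V)
    (diag (fun x => (ω 1 1 x)⁻¹) V ∘ₗ (TensorProduct.lid ℂ V).toLinearMap)
    ((TensorProduct.lid ℂ V).symm.toLinearMap ∘ₗ diag (fun x => ω 1 1 x) V)
    (graded_of_tmul (V := line 1) _ fun x y c hc v hv => by
      by_cases hx : x = 1
      · subst hx
        simp only [LinearMap.comp_apply, LinearEquiv.coe_coe, TensorProduct.lid_tmul, map_smul,
          diag_apply _ hv, one_mul]
        exact Submodule.smul_mem _ _ (Submodule.smul_mem _ _ hv)
      · rw [mem_line_ne hc hx]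
        simp)
    (by
      have h := diag_comp_inv (fun x => ω 1 1 x) V
      ext1
      ext v
      have := LinearMap.congr_fun h v
      simpa using congrArg (fun y => (1 : ℂ) ⊗ₜ[ℂ] y) this)
    (by
      have h := diag_inv_comp (fun x => ω 1 1 x) V
      ext v
      have := LinearMap.congr_fun h v
      simpa using this)

/-- The right unit constraint `v ⊗ 1 ↦ ω(|v|,1,1) v` (just `v ⊗ 1 ↦ v` if `ω` is normalized). -/
def rightUnitIso (V : VectG ω) : tensor V (line 1) ≅ V :=
  isoMk (V := tensor V (line 1))
    (diag (fun x => ω x 1 1) V ∘ₗ (TensorProduct.rid ℂ V).toLinearMap)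
    ((TensorProduct.rid ℂ V).symm.toLinearMap ∘ₗ diag (fun x => (ω x 1 1)⁻¹) V)
    (graded_of_tmul (W := line 1) _ fun x y v hv c hc => by
      by_cases hy : y = 1
      · subst hy
        simp only [LinearMap.comp_apply, LinearEquiv.coe_coe, TensorProduct.rid_tmul, map_smul,
          diag_apply _ hv, mul_one]
        exact Submodule.smul_mem _ _ (Submodule.smul_mem _ _ hv)
      · rw [mem_line_ne hc hy]
        simp)
    (by
      have h := diag_inv_comp (fun x => ω x 1 1) V
      ext v
      have := LinearMap.congr_fun h v
      simpa using congrArg (fun y => y ⊗ₜ[ℂ] (1 : ℂ)) this)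
    (by
      have h := diag_comp_inv (fun x => ω x 1 1) V
      ext v
      have := LinearMap.congr_fun h v
      simpa using this)

instance : MonoidalCategoryStruct (VectG ω) where
  tensorObj := tensor
  whiskerLeft X _ _ f := tensorMap (𝟙 X) f
  whiskerRight f Y := tensorMap f (𝟙 Y)
  tensorHom f g := tensorMap f g
  tensorUnit := line 1
  associator := assocIso
  leftUnitor := leftUnitIso
  rightUnitor := rightUnitIso

instance : MonoidalCategory (VectG ω) :=
  MonoidalCategory.ofTensorHom
    (id_tensorHom_id := fun V W => hom_ext TensorProduct.map_id)
    (id_tensorHom := fun _ _ _ _ => rfl)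
    (tensorHom_id := fun _ _ => rfl)
    (tensorHom_comp_tensorHom := fun f₁ f₂ g₁ g₂ =>
      hom_ext (TensorProduct.map_comp g₁.lin g₂.lin f₁.lin f₂.lin).symm)
    (associator_naturality := fun {X₁ X₂ X₃ Y₁ Y₂ Y₃} f₁ f₂ f₃ => by
      refine hom_ext (hext3 fun x y z u hu v hv w hw => ?_)
      change assocLin Y₁ Y₂ Y₃ ((f₁.lin u ⊗ₜ f₂.lin v) ⊗ₜ f₃.lin w) =
        TensorProduct.map f₁.lin (TensorProduct.map f₂.lin f₃.lin)
          (assocLin X₁ X₂ X₃ ((u ⊗ₜ v) ⊗ₜ w))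
      rw [assocLin_apply hu hv hw,
        assocLin_apply (lin_mem f₁ hu) (lin_mem f₂ hv) (lin_mem f₃ hw)]
      simp)
    (leftUnitor_naturality := fun {X Y} f => by
      refine hom_ext (TensorProduct.ext' fun c v => ?_)
      change diag _ Y (TensorProduct.lid ℂ Y (c ⊗ₜ f.lin v)) =
        f.lin (diag _ X (TensorProduct.lid ℂ X (c ⊗ₜ v)))
      have := LinearMap.congr_fun (diag_natural (fun x => (ω 1 1 x)⁻¹) f) v
      simp only [LinearMap.comp_apply] at this
      simp only [TensorProduct.lid_tmul, map_smul, this])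
    (rightUnitor_naturality := fun {X Y} f => by
      refine hom_ext (TensorProduct.ext' fun v c => ?_)
      change diag _ Y (TensorProduct.rid ℂ Y (f.lin v ⊗ₜ c)) =
        f.lin (diag _ X (TensorProduct.rid ℂ X (v ⊗ₜ c)))
      have := LinearMap.congr_fun (diag_natural (fun x => ω x 1 1) f) v
      simp only [LinearMap.comp_apply] at this
      simp only [TensorProduct.rid_tmul, map_smul, this])
    (pentagon := fun T U V W => by
      refine hom_ext (hext4 fun a b c d t ht u hu v hv w hw => ?_)
      change TensorProduct.map LinearMap.id (assocLin U V W) (assocLin T (tensor U V) W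
          (assocLin T U V ((t ⊗ₜ u) ⊗ₜ v) ⊗ₜ w)) =
        assocLin T U (tensor V W) (assocLin (tensor T U) V W (((t ⊗ₜ u) ⊗ₜ v) ⊗ₜ w))
      rw [assocLin_apply ht hu hv, assocLin_apply (U := tensor T U) (tmul_mem ht hu) hv hw,
        ← TensorProduct.smul_tmul', map_smul, map_smul,
        assocLin_apply (V := tensor U V) ht (tmul_mem hu hv) hw, map_smul, map_smul,
        assocLin_apply (W := tensor V W) ht hu (tmul_mem hv hw),
        TensorProduct.map_tmul, assocLin_apply hu hv hw, LinearMap.id_apply,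
        TensorProduct.tmul_smul, smul_smul, smul_smul, smul_smul]
      congr 1
      have := congrArg (Units.val) (ω.cocycle a b c d)
      push_cast at this
      linear_combination this)
    (triangle := fun V W => by
      refine hom_ext (hext3 (V := line 1) fun x y z v hv c hc w hw => ?_)
      change TensorProduct.map LinearMap.id (diag _ W ∘ₗ (TensorProduct.lid ℂ W).toLinearMap)
          (assocLin V (line 1) W ((v ⊗ₜ c) ⊗ₜ w)) =
        TensorProduct.map (diag _ V ∘ₗ (TensorProduct.rid ℂ V).toLinearMap) LinearMap.id
          ((v ⊗ₜ c) ⊗ₜ w)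
      by_cases hy : y = 1
      · subst hy
        rw [assocLin_apply (V := line 1) hv hc hw]
        simp only [map_smul, TensorProduct.map_tmul, LinearMap.comp_apply, LinearEquiv.coe_coe,
          TensorProduct.lid_tmul, TensorProduct.rid_tmul, LinearMap.id_apply, diag_apply _ hv,
          diag_apply _ hw, TensorProduct.tmul_smul, ← TensorProduct.smul_tmul', smul_smul]
        congr 1
        have h1 := congrArg (Units.val) (ω.cocycle x 1 1 z)
        simp only [one_mul, mul_one] at h1
        push_cast at h1
        have h2 : (ω x 1 z : ℂ) ≠ 0 := Units.ne_zero _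
        have h3 : (ω 1 1 z : ℂ) ≠ 0 := Units.ne_zero _
        have h4 : (ω 1 1 z : ℂ) * ω x 1 1 = ω x 1 z := by
          apply mul_right_cancel₀ h2
          linear_combination h1
        push_cast
        rw [← h4]
        field_simp
      · rw [mem_line_ne hc hy]
        simp)

end associator
end VectG

section center

variable {C : Type*} [Category C] [MonoidalCategory C]

/-- A half-braiding `σ_{V,W} : V ⊗ W ≅ W ⊗ V`, natural and multiplicative in `V`. -/
structure RightHalfBraiding (W : C) where
  σ : ∀ V : C, V ⊗ W ≅ W ⊗ V
  naturality : ∀ {V V' : C} (f : V ⟶ V'), f ▷ W ≫ (σ V').hom = (σ V).hom ≫ W ◁ f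
  hexagon : ∀ U V : C, (σ (U ⊗ V)).hom =
    (α_ U V W).hom ≫ U ◁ (σ V).hom ≫ (α_ U W V).inv ≫ (σ U).hom ▷ V ≫ (α_ W U V).hom

variable (C) in
/-- Objects of the (right) Drinfeld center of `C`. Mathlib's `CategoryTheory.Center` is its mirror
image, with half-braidings `W ⊗ V ≅ V ⊗ W`. -/
structure RightCenter where
  obj : C
  half : RightHalfBraiding obj

namespace RightCenter

/-- Morphisms of the center: morphisms of `C` compatible with the half-braidings. -/
@[ext]
structure Hom (X Y : RightCenter C) where
  f : X.obj ⟶ Y.obj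
  comm : ∀ V : C, V ◁ f ≫ (Y.half.σ V).hom = (X.half.σ V).hom ≫ f ▷ V

instance : Category (RightCenter C) where
  Hom := Hom
  id X := ⟨𝟙 X.obj, fun V => by simp⟩
  comp a b := ⟨a.f ≫ b.f, fun V => by
    rw [MonoidalCategory.whiskerLeft_comp, Category.assoc, b.comm, ← Category.assoc, a.comm,
      Category.assoc, MonoidalCategory.comp_whiskerRight]⟩

@[ext]
theorem hom_ext {X Y : RightCenter C} {a b : X ⟶ Y} (h : a.f = b.f) : a = b := Hom.ext h

/-- The braiding `σ_{V,W} : V ⊗ W → W ⊗ V` of the center, as a morphism of `C`: it is the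
half-braiding of `W`. -/
def braiding (V W : RightCenter C) : V.obj ⊗ W.obj ⟶ W.obj ⊗ V.obj := (W.half.σ V.obj).hom

/-- The square `σ_{W,V} σ_{V,W} : V ⊗ W → V ⊗ W` of the braiding. -/
def doubleBraiding (V W : RightCenter C) : V.obj ⊗ W.obj ⟶ V.obj ⊗ W.obj :=
  braiding V W ≫ braiding W V

end RightCenter

end center

/-- The Drinfeld center of `Vect_G^ω`. -/
abbrev ZVect {G : Type*} [Group G] [Fintype G] [DecidableEq G] (ω : ThreeCocycle G) :=
  RightCenter (VectG ω)

namespace ZVect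

variable {G : Type*} [Group G] [Fintype G] [DecidableEq G] {ω : ThreeCocycle G}

instance : Limits.HasZeroMorphisms (ZVect ω) where
  zero X Y := ⟨⟨0, fun V => by
    refine VectG.hom_ext (TensorProduct.ext' fun v w => ?_)
    change (Y.half.σ V).hom.lin (v ⊗ₜ[ℂ] (0 : Y.obj)) =
      TensorProduct.map (0 : X.obj →ₗ[ℂ] Y.obj) LinearMap.id ((X.half.σ V).hom.lin (v ⊗ₜ[ℂ] w))
    rw [TensorProduct.tmul_zero, TensorProduct.map_zero_left, LinearMap.zero_apply]
    exact map_zero (Y.half.σ V).hom.lin⟩⟩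
  comp_zero {X Y} f Z := RightCenter.hom_ext (Limits.comp_zero (f := f.f))
  zero_comp X {Y Z} f := RightCenter.hom_ext (Limits.zero_comp (f := f.f))

/-- The entry `S_{V,W}` of the `S`-matrix: the trace of the square of the braiding on `V ⊗ W`.
(Pivotal traces in `Z(Vect_G^ω)` are the usual traces of linear maps.) -/
def S (V W : ZVect ω) : ℂ :=
  LinearMap.trace ℂ (V.obj ⊗[ℂ] W.obj) (RightCenter.doubleBraiding V W).lin

/-- The action `w ↦ x ▹ w` of `x : G` on an object `W` of the center, determined by
`σ_{V,W} (v ⊗ w) = (|v| ▹ w) ⊗ v`; it is read off from the one-dimensional `V` of degree `x`. -/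
def act (W : ZVect ω) (x : G) : W.obj →ₗ[ℂ] W.obj :=
  (TensorProduct.rid ℂ W.obj).toLinearMap ∘ₗ
    ((W.half.σ (VectG.line x)).hom.lin : (ℂ ⊗[ℂ] W.obj) →ₗ[ℂ] (W.obj ⊗[ℂ] ℂ)) ∘ₗ
      (TensorProduct.lid ℂ W.obj).symm.toLinearMap

theorem rid_proj (W : VectG ω) (x z : G) (t : W ⊗[ℂ] ℂ) :
    TensorProduct.rid ℂ W ((VectG.tensor W (VectG.line x)).proj z t) =
      W.proj (z * x⁻¹) (TensorProduct.rid ℂ W t) := by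
  induction t with
  | zero => simp only [map_zero]
  | add a b ha hb => simp only [map_add, ha, hb]
  | tmul w c =>
    simp only [LinearMap.sum_apply, TensorProduct.map_tmul, map_sum]
    rw [Finset.sum_eq_single (z * x⁻¹)]
    · simp
    · intro y _ hy
      rw [if_neg]
      · simp
      · rintro rfl
        simp at hy
    · simp

/-- `|x ▹ w| = x |w| x⁻¹`. -/
theorem act_mem (W : ZVect ω) (x : G) {y : G} {w : W.obj} (hw : w ∈ W.obj.component y) :
    act W x w ∈ W.obj.component (x * y * x⁻¹) := by
  have h1 := VectG.lin_mem (W.half.σ (VectG.line x)).hom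
    (VectG.tmul_mem (VectG.mem_line (ω := ω) x 1) hw)
  rw [VectG.mem_component]
  change W.obj.proj (x * y * x⁻¹) (TensorProduct.rid ℂ W.obj _) = TensorProduct.rid ℂ W.obj _
  rw [← rid_proj]
  exact congrArg _ (VectG.mem_component.1 h1)

theorem act_mem_centralizer (W : ZVect ω) (g : G) (c : Subgroup.centralizer {g}) :
    ∀ w ∈ W.obj.component g, act W c w ∈ W.obj.component g := by
  intro w hw
  have h := act_mem W (c : G) hw
  rwa [Subgroup.mem_centralizer_singleton_iff.1 c.2, mul_inv_cancel_right] at h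

/-- The projective character of `C_G(g)` on the component `W_g`: `c ↦ tr (c ▹ : W_g → W_g)`. -/
def character (W : ZVect ω) (g : G) (c : Subgroup.centralizer {g}) : ℂ :=
  LinearMap.trace ℂ (W.obj.component g) ((act W c).restrict (act_mem_centralizer W g c))

/-- `V` is the simple object of `Z(Vect_G^ω)` corresponding to the pair `(g, χ)`: it is simple,
`g` is one of its degrees, and `χ` is the projective character of `C_G(g)` on `V_g`. -/
structure IsSimpleWith (V : ZVect ω) (g : G) (χ : Subgroup.centralizer {g} → ℂ) : Prop where
  simple : Simple V
  component_ne_bot : V.obj.component g ≠ ⊥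
  character_eq : V.character g = χ

end ZVect

section formula

variable {G : Type*} [Group G]

/-- `p ▹ h = p h p⁻¹`. -/
def hit (p h : G) : G := p * h * p⁻¹

/-- `α_g(x,y)`. The convention is the one for which `x ▹ (y ▹ w) = α_{|w|}(x,y) (xy ▹ w)` holds when
the associativity constraint is `(u ⊗ v) ⊗ w ↦ ω(|u|,|v|,|w|) u ⊗ (v ⊗ w)`. -/
def alpha (ω : ThreeCocycle G) (g x y : G) : ℂˣ :=
  (ω x y g)⁻¹ * ω x (hit y g) y * (ω (hit (x * y) g) x y)⁻¹

theorem hit_mem_centralizer {p g h : G} (hp : Commute (hit p g) h) :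
    hit p g ∈ Subgroup.centralizer {h} :=
  Subgroup.mem_centralizer_singleton_iff.2 hp

theorem inv_hit_mem_centralizer {p g h : G} (hp : Commute (hit p g) h) :
    hit p⁻¹ h ∈ Subgroup.centralizer {g} := by
  rw [Subgroup.mem_centralizer_singleton_iff]
  have h1 : p * g * p⁻¹ * h = h * (p * g * p⁻¹) := hp
  calc hit p⁻¹ h * g = p⁻¹ * (h * (p * g * p⁻¹)) * p := by simp [hit, mul_assoc]
    _ = p⁻¹ * (p * g * p⁻¹ * h) * p := by rw [h1]
    _ = g * hit p⁻¹ h := by simp [hit, mul_assoc]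

open scoped Classical in
/-- `α_g(h,p) α_g⁻¹(p, p⁻¹ ▹ h) χ₁(p⁻¹ ▹ h) χ₂(p ▹ g)` if `[p ▹ g, h] = 1`, and `0` otherwise. -/
def sTerm (ω : ThreeCocycle G) (g h : G) (χ₁ : Subgroup.centralizer {g} → ℂ)
    (χ₂ : Subgroup.centralizer {h} → ℂ) (p : G) : ℂ :=
  if hp : Commute (hit p g) h then
    (alpha ω g h p : ℂ) * ((alpha ω g p (hit p⁻¹ h))⁻¹ : ℂˣ) *
      χ₁ ⟨hit p⁻¹ h, inv_hit_mem_centralizer hp⟩ * χ₂ ⟨hit p g, hit_mem_centralizer hp⟩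
  else 0

open scoped Classical in
/-- `χ₁^{(x)}(y) χ₂^{(y)}(x)` if `[x, y] = 1`, and `0` otherwise, where `χ₁^{(x)}` is the projective
character of `C_G(x)` on `V_x` and `χ₂^{(y)}` that of `C_G(y)` on `W_y`. -/
def pairTerm [Fintype G] [DecidableEq G] {ω : ThreeCocycle G} (V W : ZVect ω) (x y : G) : ℂ :=
  if hxy : Commute x y then
    V.character x ⟨y, Subgroup.mem_centralizer_singleton_iff.2 hxy.symm⟩ *
      W.character y ⟨x, Subgroup.mem_centralizer_singleton_iff.2 hxy⟩
  else 0

end formula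

end

/-!
By naturality along the morphisms from a line, a half-braiding of `W` is
`v ⊗ w ↦ (x ▹ w) ⊗ v` for `v` of degree `x` (`ZVect.half_apply`), and the hexagon makes `▹` a
projective action with multiplier `α` (`ZVect.act_act`). The double braiding is therefore given
on `V_x ⊗ W_y` by `v ⊗ w ↦ ((x ▹ y) ▹ v) ⊗ (x ▹ w)` (`ZVect.doubleBraiding_apply`). Only
commuting pairs `(x, y)` contribute to its trace, each with
`tr (y ▹ : V_x → V_x) * tr (x ▹ : W_y → W_y)`; this is `ZVect.S_eq_sum`, valid for all objects. The
part of `V` supported on a conjugacy class is a direct summand in the center, so the degrees of a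
simple object form one class (`ZVect.component_eq_bot_of_simple`), and the double sum follows.

For the single sums, conjugation by `p ▹ : V_g → V_{p ▹ g}` turns the character on `V_{p ▹ g}` into
the one on `V_g` times `α_g(y, p) α_g(p, p⁻¹ ▹ y)⁻¹` (`ZVect.gradedTrace_hit`). This has two
consequences. The summand for `p` is the pair term at `(p ▹ g, h)` (`ZVect.sTerm_eq_pairTerm`), and
the pair terms are invariant under simultaneous conjugation, the multipliers for `V` and `W` being
inverse to each other (`ZVect.pairTerm_hit`). Hence the inner sum over `ḡ` is the same for every
`y ∈ h̄`, which produces the factor `|h̄|`; the three index sets for the remaining sum are related by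
orbit–stabilizer (`sum_representatives`, `sum_hit`).
-/

noncomputable section

/-! ### The action of `G` on an object of the center -/

namespace VectG

variable {G : Type*} [Group G] [Fintype G] [DecidableEq G] {ω : ThreeCocycle G}

/-- The morphism `line x ⟶ V` picking out a homogeneous vector of degree `x`. -/
def ofMem {V : VectG ω} {x : G} {v : V} (hv : v ∈ V.component x) : line (ω := ω) x ⟶ V :=
  homMk (V := line x) (LinearMap.toSpanSingleton ℂ V v) fun y c hc => by
    by_cases hy : y = x
    · subst hy
      exact Submodule.smul_mem _ _ hv
    · rw [mem_line_ne hc hy, map_zero]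
      exact Submodule.zero_mem _

theorem ofMem_lin_one {V : VectG ω} {x : G} {v : V} (hv : v ∈ V.component x) :
    (ofMem hv).lin (1 : ℂ) = v :=
  one_smul ℂ v

end VectG

namespace ZVect

variable {G : Type*} [Group G] [Fintype G] [DecidableEq G] {ω : ThreeCocycle G}

theorem half_line_apply (W : ZVect ω) (x : G) (w : W.obj) :
    (W.half.σ (VectG.line x)).hom.lin ((1 : ℂ) ⊗ₜ[ℂ] w) = act W x w ⊗ₜ[ℂ] (1 : ℂ) := by
  apply (TensorProduct.rid ℂ W.obj).injective
  rw [TensorProduct.rid_tmul, one_smul]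
  rfl

/-- Naturality of the half-braiding along `line x ⟶ V` reduces it to the action:
`σ_{V,W} (v ⊗ w) = (x ▹ w) ⊗ v` for `v` of degree `x`. -/
theorem half_apply (W : ZVect ω) {V : VectG ω} {x : G} {v : V} (hv : v ∈ V.component x)
    (w : W.obj) : (W.half.σ V).hom.lin (v ⊗ₜ[ℂ] w) = act W x w ⊗ₜ[ℂ] v := by
  have h := LinearMap.congr_fun
    (congrArg VectG.Hom.lin (W.half.naturality (VectG.ofMem hv))) ((1 : ℂ) ⊗ₜ[ℂ] w)
  change (W.half.σ V).hom.lin ((VectG.ofMem hv).lin (1 : ℂ) ⊗ₜ[ℂ] w) =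
    TensorProduct.map LinearMap.id (VectG.ofMem hv).lin
      ((W.half.σ (VectG.line x)).hom.lin ((1 : ℂ) ⊗ₜ[ℂ] w)) at h
  rw [half_line_apply, VectG.ofMem_lin_one] at h
  rw [h]
  exact congrArg (act W x w ⊗ₜ[ℂ] ·) (VectG.ofMem_lin_one hv)

/-- The action of a group element as a linear automorphism. -/
def actEquiv (W : ZVect ω) (x : G) : W.obj ≃ₗ[ℂ] W.obj :=
  LinearEquiv.ofBijective (act W x) <| by
    have h1 := congrArg VectG.Hom.lin (W.half.σ (VectG.line x)).hom_inv_id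
    have h2 := congrArg VectG.Hom.lin (W.half.σ (VectG.line x)).inv_hom_id
    have hσ : Function.Bijective (W.half.σ (VectG.line x)).hom.lin :=
      Function.bijective_iff_has_inverse.2
        ⟨(W.half.σ (VectG.line x)).inv.lin, fun t => LinearMap.congr_fun h1 t,
          fun t => LinearMap.congr_fun h2 t⟩
    exact (TensorProduct.rid ℂ W.obj).bijective.comp
      (hσ.comp (TensorProduct.lid ℂ W.obj).symm.bijective)

/-- The hexagon axiom on two lines: the action is projective, with multiplier `α`. -/
theorem act_act (W : ZVect ω) (x y : G) {g : G} {w : W.obj} (hw : w ∈ W.obj.component g) :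
    act W x (act W y w) = (alpha ω g x y : ℂ) • act W (x * y) w := by
  have hx := VectG.mem_line (ω := ω) x 1
  have hy := VectG.mem_line (ω := ω) y 1
  have h := LinearMap.congr_fun (congrArg VectG.Hom.lin
    (W.half.hexagon (VectG.line x) (VectG.line y))) (((1 : ℂ) ⊗ₜ[ℂ] (1 : ℂ)) ⊗ₜ[ℂ] w)
  change (W.half.σ (VectG.tensor (VectG.line x) (VectG.line y))).hom.lin
      (((1 : ℂ) ⊗ₜ[ℂ] (1 : ℂ)) ⊗ₜ[ℂ] w) =
    VectG.assocLin W.obj (VectG.line x) (VectG.line y)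
      (TensorProduct.map (W.half.σ (VectG.line x)).hom.lin LinearMap.id
        (VectG.assocInvLin (VectG.line x) W.obj (VectG.line y)
          (TensorProduct.map LinearMap.id (W.half.σ (VectG.line y)).hom.lin
            (VectG.assocLin (VectG.line x) (VectG.line y) W.obj
              (((1 : ℂ) ⊗ₜ[ℂ] (1 : ℂ)) ⊗ₜ[ℂ] w))))) at h
  have hyw := act_mem W y hw
  have hxyw := act_mem W x hyw
  rw [half_apply W (VectG.tmul_mem hx hy), VectG.assocLin_apply hx hy hw, map_smul,
    TensorProduct.map_tmul, half_apply W hy, map_smul, LinearMap.id_apply,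
    VectG.assocInvLin_apply hx hyw hy, map_smul, map_smul, map_smul, map_smul,
    TensorProduct.map_tmul, half_apply W hx, LinearMap.id_apply, VectG.assocLin_apply hxyw hx hy] at h
  -- identify `W ⊗ (ℂ ⊗ ℂ)` with `W` to compare the two vectors there
  have h' := congrArg (fun t => TensorProduct.rid ℂ W.obj
    (TensorProduct.map LinearMap.id (TensorProduct.lid ℂ ℂ).toLinearMap t)) h
  simp only [map_smul, TensorProduct.map_tmul, LinearMap.id_apply, LinearEquiv.coe_coe,
    TensorProduct.lid_tmul, TensorProduct.rid_tmul, one_smul, smul_smul] at h'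
  rw [h', smul_smul]
  have e1 := (ω x y g).ne_zero
  have e2 := (ω x (y * g * y⁻¹) y).ne_zero
  have e3 := (ω (x * (y * g * y⁻¹) * x⁻¹) x y).ne_zero
  have e4 : x * y * g * (x * y)⁻¹ = x * (y * g * y⁻¹) * x⁻¹ := by group
  simp only [alpha, hit, e4]
  push_cast
  field_simp
  simp

/-! ### Traces on homogeneous components -/

/-- The trace of `z ▹` on the component `V_x`, as the trace on all of `V` of `z ▹` precomposed with
the projection to `V_x`. Unlike `character`, it makes sense for every `z`, and it vanishes unless
`z` commutes with `x`. -/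
def gradedTrace (V : ZVect ω) (x z : G) : ℂ :=
  LinearMap.trace ℂ V.obj (act V z ∘ₗ V.obj.proj x)

theorem gradedTrace_of_not_commute (V : ZVect ω) {x z : G} (h : ¬ Commute x z) :
    gradedTrace V x z = 0 := by
  have h0 : V.obj.proj x ∘ₗ (act V z ∘ₗ V.obj.proj x) = 0 := by
    ext v
    refine VectG.proj_of_mem_ne (act_mem V z (V.obj.proj_mem x v)) fun hx => h ?_
    have := mul_inv_eq_iff_eq_mul.1 hx.symm
    exact this.symm
  have h1 : V.obj.proj x ∘ₗ V.obj.proj x = V.obj.proj x := LinearMap.ext (V.obj.proj_same x)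
  rw [gradedTrace, ← h1, ← LinearMap.comp_assoc, LinearMap.trace_comp_comm', h0, map_zero]

theorem gradedTrace_eq_character (V : ZVect ω) (x : G) (c : Subgroup.centralizer {x}) :
    gradedTrace V x c = V.character x c := by
  let P : V.obj →ₗ[ℂ] V.obj.component x := (V.obj.proj x).rangeRestrict
  let A := (act V (c : G)).restrict (act_mem_centralizer V x c)
  have h1 : act V (c : G) ∘ₗ V.obj.proj x = ((V.obj.component x).subtype ∘ₗ A) ∘ₗ P := by
    ext v
    rfl
  have h2 : P ∘ₗ (V.obj.component x).subtype ∘ₗ A = A := by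
    ext v
    exact VectG.mem_component.1 (A v).2
  rw [gradedTrace, h1, LinearMap.trace_comp_comm', h2]
  rfl

theorem gradedTrace_eq_zero (V : ZVect ω) {x : G} (h : V.obj.component x = ⊥) (z : G) :
    gradedTrace V x z = 0 := by
  rw [gradedTrace, LinearMap.range_eq_bot.1 h, LinearMap.comp_zero, map_zero]

theorem pairTerm_eq (V W : ZVect ω) (x y : G) :
    pairTerm V W x y = gradedTrace V x y * gradedTrace W y x := by
  unfold pairTerm
  split_ifs with h
  · rw [← gradedTrace_eq_character, ← gradedTrace_eq_character]
  · rw [gradedTrace_of_not_commute V h, zero_mul]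

theorem act_comp_proj (V : ZVect ω) (p g : G) :
    act V p ∘ₗ V.obj.proj g = V.obj.proj (hit p g) ∘ₗ act V p := by
  refine VectG.hext1 fun x v hv => ?_
  have h := act_mem V p hv
  by_cases hx : g = x
  · subst hx
    rw [LinearMap.comp_apply, VectG.mem_component.1 hv]
    exact (VectG.mem_component.1 h).symm
  · rw [LinearMap.comp_apply, VectG.proj_of_mem_ne hv hx, map_zero]
    refine (VectG.proj_of_mem_ne h fun e => hx ?_).symm
    simpa [hit] using e

/-- Conjugating by the isomorphism `p ▹ : V_g → V_{p ▹ g}` changes the projective character by a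
quotient of values of `α`. -/
theorem gradedTrace_hit (V : ZVect ω) (p g y : G) :
    gradedTrace V (hit p g) y =
      (alpha ω g y p : ℂ) * ((alpha ω g p (hit p⁻¹ y))⁻¹ : ℂˣ) *
        gradedTrace V g (hit p⁻¹ y) := by
  set k : ℂ := (alpha ω g y p : ℂ) * ((alpha ω g p (hit p⁻¹ y))⁻¹ : ℂˣ) with hk
  have h1 : act V y ∘ₗ act V p ∘ₗ V.obj.proj g =
      k • (act V p ∘ₗ act V (hit p⁻¹ y) ∘ₗ V.obj.proj g) := by
    ext v
    have hv := V.obj.proj_mem g v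
    simp only [LinearMap.comp_apply, LinearMap.smul_apply]
    have e : p * hit p⁻¹ y = y * p := by simp [hit, mul_assoc]
    rw [act_act V y p hv, act_act V p _ hv, smul_smul, hk, e, mul_assoc, Units.inv_mul, mul_one]
  have h2 : act V p ∘ₗ (actEquiv V p).symm.toLinearMap = LinearMap.id :=
    LinearMap.ext fun v => (actEquiv V p).apply_symm_apply v
  have h3 : (actEquiv V p).symm.toLinearMap ∘ₗ act V p = LinearMap.id :=
    LinearMap.ext fun v => (actEquiv V p).symm_apply_apply v
  have h4 : act V y ∘ₗ V.obj.proj (hit p g) =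
      k • (act V p ∘ₗ ((act V (hit p⁻¹ y) ∘ₗ V.obj.proj g) ∘ₗ
        (actEquiv V p).symm.toLinearMap)) := by
    calc act V y ∘ₗ V.obj.proj (hit p g)
        = act V y ∘ₗ V.obj.proj (hit p g) ∘ₗ (act V p ∘ₗ (actEquiv V p).symm.toLinearMap) := by
          rw [h2, LinearMap.comp_id]
      _ = (act V y ∘ₗ (act V p ∘ₗ V.obj.proj g)) ∘ₗ (actEquiv V p).symm.toLinearMap := by
          rw [act_comp_proj]; rfl
      _ = _ := by rw [h1]; rfl
  rw [gradedTrace, h4, map_smul, LinearMap.trace_comp_comm', LinearMap.comp_assoc, h3,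
    LinearMap.comp_id]
  rfl

/-- The scalars by which the two characters in `pairTerm` change under simultaneous conjugation
cancel: every value of `ω` occurs as often with exponent `1` as with exponent `-1`. -/
theorem pairTerm_hit (V W : ZVect ω) (q x y : G) :
    pairTerm V W (hit q x) (hit q y) = pairTerm V W x y := by
  have hq : ∀ z : G, hit q⁻¹ (hit q z) = z := fun z => by simp [hit, mul_assoc]
  rw [pairTerm_eq, pairTerm_eq, gradedTrace_hit V q x, gradedTrace_hit W q y, hq, hq]
  by_cases h : Commute x y
  · have a1 : hit y x = x := by rw [hit, ← h.eq, mul_inv_cancel_right]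
    have a2 : hit x y = y := by rw [hit, h.eq, mul_inv_cancel_right]
    have a3 : hit (hit q y * q) x = hit q x := by
      conv_rhs => rw [← a1]
      simp [hit, mul_assoc]
    have a4 : hit (hit q x * q) y = hit q y := by
      conv_rhs => rw [← a2]
      simp [hit, mul_assoc]
    have a5 : hit (q * y) x = hit q x := by
      conv_rhs => rw [← a1]
      simp [hit, mul_assoc]
    have a6 : hit (q * x) y = hit q y := by
      conv_rhs => rw [← a2]
      simp [hit, mul_assoc]
    have key : alpha ω x (hit q y) q * (alpha ω x q y)⁻¹ *
        (alpha ω y (hit q x) q * (alpha ω y q x)⁻¹) = 1 := by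
      simp only [alpha, a1, a2, a3, a4, a5, a6]
      ext
      push_cast
      field_simp
    have key' := congrArg Units.val key
    simp only [Units.val_mul, Units.val_one] at key'
    linear_combination (gradedTrace V x y * gradedTrace W y x) * key'
  · rw [gradedTrace_of_not_commute V h]
    ring

theorem sTerm_eq_pairTerm (V W : ZVect ω) (g h p : G) :
    sTerm ω g h (V.character g) (W.character h) p = pairTerm V W (hit p g) h := by
  unfold sTerm
  split_ifs with hp
  · rw [pairTerm_eq, gradedTrace_hit, ← gradedTrace_eq_character, ← gradedTrace_eq_character]
  · rw [pairTerm, dif_neg hp]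

/-! ### The trace of the double braiding -/

theorem doubleBraiding_apply (V W : ZVect ω) {x y : G} {v : V.obj} {w : W.obj}
    (hv : v ∈ V.obj.component x) (hw : w ∈ W.obj.component y) :
    (RightCenter.doubleBraiding V W).lin (v ⊗ₜ[ℂ] w) =
      act V (hit x y) v ⊗ₜ[ℂ] act W x w := by
  change (V.half.σ W.obj).hom.lin ((W.half.σ V.obj).hom.lin (v ⊗ₜ[ℂ] w)) = _
  rw [half_apply W hv]
  exact half_apply V (act_mem W x hw) v

/-- The trace of the double braiding, for arbitrary objects of the center: it maps `V_x ⊗ W_y` to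
itself only if `x` and `y` commute, and is then the tensor product of `y ▹` and `x ▹`. -/
theorem S_eq_sum (V W : ZVect ω) : V.S W = ∑ x, ∑ y, pairTerm V W x y := by
  have h : ((RightCenter.doubleBraiding V W).lin : V.obj ⊗[ℂ] W.obj →ₗ[ℂ] V.obj ⊗[ℂ] W.obj) =
      ∑ x, ∑ y, TensorProduct.map (act V (hit x y) ∘ₗ V.obj.proj x)
        (act W x ∘ₗ W.obj.proj y) := by
    refine VectG.hext2 fun x y v hv w hw => ?_
    refine (doubleBraiding_apply V W hv hw).trans ?_
    simp only [LinearMap.sum_apply, TensorProduct.map_tmul, LinearMap.comp_apply]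
    rw [Finset.sum_eq_single x, Finset.sum_eq_single y]
    · rw [VectG.mem_component.1 hv, VectG.mem_component.1 hw]
    · intro b _ hb
      rw [VectG.proj_of_mem_ne hw hb, map_zero, TensorProduct.tmul_zero]
    · simp
    · intro a _ ha
      simp [VectG.proj_of_mem_ne hv ha]
    · simp
  unfold S
  rw [h]
  simp only [map_sum, LinearMap.trace_tensorProduct']
  refine Finset.sum_congr rfl fun x _ => Finset.sum_congr rfl fun y _ => ?_
  rw [pairTerm_eq]
  change gradedTrace V x (hit x y) * gradedTrace W y x = _
  by_cases hxy : Commute x y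
  · rw [hit, hxy.eq, mul_inv_cancel_right]
  · rw [gradedTrace_of_not_commute W (fun h => hxy h.symm), mul_zero, mul_zero]

end ZVect

/-! ### Direct summands in the center -/

namespace RightCenter

variable {C : Type*} [Category C] [MonoidalCategory C]

/-- An idempotent of the center splits in the center as soon as it splits in `C`: the half-braiding
of the summand is the compression of the given one. The hypothesis `hri` says that the idempotent
`r ≫ i` is a morphism of the center. -/
def retract (Z : RightCenter C) {Y : C} (i : Y ⟶ Z.obj) (r : Z.obj ⟶ Y) (hir : i ≫ r = 𝟙 Y)
    (hri : ∀ U : C, U ◁ r ≫ U ◁ i ≫ (Z.half.σ U).hom = (Z.half.σ U).hom ≫ r ▷ U ≫ i ▷ U) :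
    RightCenter C where
  obj := Y
  half :=
    { σ := fun U =>
        { hom := U ◁ i ≫ (Z.half.σ U).hom ≫ r ▷ U
          inv := i ▷ U ≫ (Z.half.σ U).inv ≫ U ◁ r
          hom_inv_id := by
            have h := hri U
            calc (U ◁ i ≫ (Z.half.σ U).hom ≫ r ▷ U) ≫ i ▷ U ≫ (Z.half.σ U).inv ≫ U ◁ r
                = U ◁ i ≫ ((Z.half.σ U).hom ≫ r ▷ U ≫ i ▷ U) ≫ (Z.half.σ U).inv ≫ U ◁ r := by
                  simp only [Category.assoc]
              _ = U ◁ (i ≫ r) ≫ U ◁ (i ≫ r) := by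
                  rw [← h]; simp
              _ = 𝟙 _ := by simp [hir]
          inv_hom_id := by
            have h := hri U
            calc (i ▷ U ≫ (Z.half.σ U).inv ≫ U ◁ r) ≫ U ◁ i ≫ (Z.half.σ U).hom ≫ r ▷ U
                = i ▷ U ≫ (Z.half.σ U).inv ≫ (U ◁ r ≫ U ◁ i ≫ (Z.half.σ U).hom) ≫ r ▷ U := by
                  simp only [Category.assoc]
              _ = (i ≫ r) ▷ U ≫ (i ≫ r) ▷ U := by
                  rw [h]; simp
              _ = 𝟙 _ := by simp [hir] }
      naturality := fun {U U'} f => by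
        have h := Z.half.naturality f
        rw [← whisker_exchange_assoc, reassoc_of% h]
        simp only [Category.assoc, whisker_exchange]
      hexagon := fun U V => by
        have hr : r ≫ i ≫ r = r := by rw [hir, Category.comp_id]
        -- in the composite of the two compressed half-braidings, the idempotent `r ≫ i` between
        -- them can be dropped: it commutes with `σ U` and is then absorbed by `r`
        have h : (U ◁ r ≫ U ◁ i ≫ (Z.half.σ U).hom ≫ r ▷ U) ▷ V =
            ((Z.half.σ U).hom ≫ r ▷ U) ▷ V := by
          have := hri U =≫ r ▷ U
          simp only [Category.assoc, ← comp_whiskerRight, hr] at this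
          rw [this]
        simp only [comp_whiskerRight] at h
        simp only [Z.half.hexagon, MonoidalCategory.whiskerLeft_comp, comp_whiskerRight,
          Category.assoc]
        simp only [associator_inv_naturality_middle_assoc]
        rw [reassoc_of% h]
        simp }

/-- The inclusion of a retract, as a morphism of the center. -/
def retractι (Z : RightCenter C) {Y : C} (i : Y ⟶ Z.obj) (r : Z.obj ⟶ Y) (hir : i ≫ r = 𝟙 Y)
    (hri : ∀ U : C, U ◁ r ≫ U ◁ i ≫ (Z.half.σ U).hom = (Z.half.σ U).hom ≫ r ▷ U ≫ i ▷ U) :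
    Z.retract i r hir hri ⟶ Z where
  f := i
  comm U := by
    change _ = (U ◁ i ≫ (Z.half.σ U).hom ≫ r ▷ U) ≫ i ▷ U
    rw [Category.assoc, Category.assoc, ← hri, ← MonoidalCategory.whiskerLeft_comp_assoc, hir,
      MonoidalCategory.whiskerLeft_id, Category.id_comp]
    rfl

theorem mono_retractι (Z : RightCenter C) {Y : C} (i : Y ⟶ Z.obj) (r : Z.obj ⟶ Y)
    (hir : i ≫ r = 𝟙 Y)
    (hri : ∀ U : C, U ◁ r ≫ U ◁ i ≫ (Z.half.σ U).hom = (Z.half.σ U).hom ≫ r ▷ U ≫ i ▷ U) :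
    Mono (Z.retractι i r hir hri) where
  right_cancellation a b hab := by
    apply hom_ext
    have h : a.f ≫ i = b.f ≫ i := congrArg Hom.f hab
    have := (SplitMono.mk r hir).mono
    exact (cancel_mono i).1 h

end RightCenter

namespace VectG

variable {G : Type*} [Group G] [Fintype G] {ω : ThreeCocycle G}

/-- The subspace `⨁_{x ∈ s} V_x`, as the common kernel of the other projections. -/
def supportedSubmodule (V : VectG ω) (s : Set G) : Submodule ℂ V :=
  ⨅ x ∈ sᶜ, LinearMap.ker (V.proj x)

theorem mem_supportedSubmodule {V : VectG ω} {s : Set G} {v : V} :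
    v ∈ V.supportedSubmodule s ↔ ∀ x ∉ s, V.proj x v = 0 := by
  simp [supportedSubmodule]

theorem component_le_supportedSubmodule {V : VectG ω} {s : Set G} {x : G} (hx : x ∈ s) :
    V.component x ≤ V.supportedSubmodule s := fun _ hv =>
  mem_supportedSubmodule.2 fun _ hy => proj_of_mem_ne hv fun e => hy (e ▸ hx)

theorem proj_mem_supportedSubmodule {V : VectG ω} {s : Set G} (x : G) {v : V}
    (hv : v ∈ V.supportedSubmodule s) : V.proj x v ∈ V.supportedSubmodule s := by
  by_cases hx : x ∈ s
  · exact component_le_supportedSubmodule hx (V.proj_mem x v)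
  · rw [mem_supportedSubmodule.1 hv x hx]
    exact Submodule.zero_mem _

/-- The graded vector space `⨁_{x ∈ s} V_x`. -/
def supported (V : VectG ω) (s : Set G) : VectG ω where
  carrier := V.supportedSubmodule s
  proj x := (V.proj x).restrict fun _ => proj_mem_supportedSubmodule x
  proj_same x v := Subtype.ext (V.proj_same x v)
  proj_ne x y v h := Subtype.ext (V.proj_ne x y v h)
  sum_proj v := Subtype.ext <| by
    rw [AddSubmonoidClass.coe_finsetSum]
    exact V.sum_proj v

/-- The inclusion of `⨁_{x ∈ s} V_x`. -/
def supportedι (V : VectG ω) (s : Set G) : V.supported s ⟶ V :=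
  ⟨(V.supportedSubmodule s).subtype, fun _ _ => rfl⟩

open scoped Classical in
theorem sum_proj_mem (V : VectG ω) (s : Set G) (v : V) :
    (∑ x with x ∈ s, V.proj x) v ∈ V.supportedSubmodule s := by
  rw [LinearMap.sum_apply]
  exact Submodule.sum_mem _ fun x hx =>
    component_le_supportedSubmodule (Finset.mem_filter.1 hx).2 (V.proj_mem x v)

open scoped Classical in
/-- The projection onto `⨁_{x ∈ s} V_x`. -/
def supportedπ (V : VectG ω) (s : Set G) : V ⟶ V.supported s :=
  ⟨(∑ x with x ∈ s, V.proj x).codRestrict (V.supportedSubmodule s) (V.sum_proj_mem s),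
    fun x v => Subtype.ext <| by
      change (∑ y with y ∈ s, V.proj y) (V.proj x v) = V.proj x ((∑ y with y ∈ s, V.proj y) v)
      simp only [LinearMap.sum_apply, map_sum]
      refine Finset.sum_congr rfl fun y _ => ?_
      by_cases h : x = y
      · rw [h]
      · rw [V.proj_ne _ _ _ h, V.proj_ne _ _ _ (Ne.symm h)]⟩

theorem supportedι_supportedπ (V : VectG ω) (s : Set G) :
    V.supportedι s ≫ V.supportedπ s = 𝟙 _ := by
  classical
  refine hom_ext (LinearMap.ext fun v => Subtype.ext ?_)
  change (∑ x with x ∈ s, V.proj x) v.1 = v.1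
  conv_rhs => rw [← V.sum_proj v.1]
  rw [LinearMap.sum_apply]
  exact Finset.sum_filter_of_ne fun x _ hx => by
    by_contra h
    exact hx (mem_supportedSubmodule.1 v.2 x h)

open scoped Classical in
theorem supportedπ_supportedι_apply {V : VectG ω} (s : Set G) {x : G} {v : V}
    (hv : v ∈ V.component x) :
    (V.supportedι s).lin ((V.supportedπ s).lin v) = if x ∈ s then v else 0 := by
  change (∑ y with y ∈ s, V.proj y) v = _
  rw [LinearMap.sum_apply, Finset.sum_filter, Finset.sum_eq_single x]
  · rw [mem_component.1 hv]
  · intro y _ hy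
    rw [proj_of_mem_ne hv hy, ite_self]
  · simp

end VectG

/-! ### Degrees of simple objects -/

namespace ZVect

variable {G : Type*} [Group G] [Fintype G] [DecidableEq G] {ω : ThreeCocycle G}

/-- The degrees of a simple object form a single conjugacy class: the part of `V` supported on a
conjugacy class is a direct summand in the center. -/
theorem component_eq_bot_of_simple {V : ZVect ω} (hV : Simple V) {g x : G}
    (hg : V.obj.component g ≠ ⊥) (hx : ¬ IsConj g x) : V.obj.component x = ⊥ := by
  classical
  set i := V.obj.supportedι (conjugatesOf g)
  set r := V.obj.supportedπ (conjugatesOf g)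
  -- the projection commutes with the half-braiding because a conjugacy class is stable under `▹`
  have hri : ∀ U : VectG ω,
      U ◁ r ≫ U ◁ i ≫ (V.half.σ U).hom = (V.half.σ U).hom ≫ r ▷ U ≫ i ▷ U := by
    intro U
    refine VectG.hom_ext (VectG.hext2 fun a b u hu v hv => ?_)
    change (V.half.σ U).hom.lin (u ⊗ₜ[ℂ] i.lin (r.lin v)) =
      TensorProduct.map i.lin LinearMap.id (TensorProduct.map r.lin LinearMap.id
        ((V.half.σ U).hom.lin (u ⊗ₜ[ℂ] v)))
    rw [half_apply V hu, half_apply V hu, TensorProduct.map_tmul, TensorProduct.map_tmul,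
      VectG.supportedπ_supportedι_apply _ hv,
      VectG.supportedπ_supportedι_apply _ (act_mem V a hv)]
    have hc : a * b * a⁻¹ ∈ conjugatesOf g ↔ b ∈ conjugatesOf g := by
      have hb : IsConj b (a * b * a⁻¹) := isConj_iff.2 ⟨a, rfl⟩
      exact ⟨fun h => h.trans hb.symm, fun h => h.trans hb⟩
    simp only [hc]
    split_ifs <;> simp
  have hir := V.obj.supportedι_supportedπ (conjugatesOf g)
  have := V.mono_retractι i r hir hri
  have hne : V.retractι i r hir hri ≠ 0 := by
    intro h0
    apply hg
    rw [Submodule.eq_bot_iff]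
    intro v hv
    have hv' : v ∈ V.obj.supportedSubmodule (conjugatesOf g) :=
      VectG.component_le_supportedSubmodule (mem_conjugatesOf_self (a := g)) hv
    exact LinearMap.congr_fun (congrArg (fun f => VectG.Hom.lin (RightCenter.Hom.f f)) h0)
      (⟨v, hv'⟩ : V.obj.supportedSubmodule (conjugatesOf g))
  -- by simplicity the inclusion of the summand is invertible, so every vector lies in it
  have hiso : IsIso (V.retractι i r hir hri) := (Simple.mono_isIso_iff_nonzero _).2 hne
  rw [Submodule.eq_bot_iff]
  intro v hv
  have h1 := LinearMap.congr_fun (congrArg (fun f => VectG.Hom.lin (RightCenter.Hom.f f))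
    (IsIso.inv_hom_id (V.retractι i r hir hri))) v
  set w := (inv (V.retractι i r hir hri)).f.lin v
  have h2 : (w : V.obj.supportedSubmodule (conjugatesOf g)).1 = v := h1
  have h3 := VectG.mem_supportedSubmodule.1
    (w : V.obj.supportedSubmodule (conjugatesOf g)).2 x hx
  rw [h2] at h3
  exact (VectG.mem_component.1 hv).symm.trans h3

open scoped Classical in
theorem S_eq_sum_isConj {V W : ZVect ω} {g h : G} (hV : Simple V) (hW : Simple W)
    (hg : V.obj.component g ≠ ⊥) (hh : W.obj.component h ≠ ⊥) :
    V.S W = ∑ x with IsConj g x, ∑ y with IsConj h y, pairTerm V W x y := by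
  rw [S_eq_sum]
  symm
  calc _ = ∑ x with IsConj g x, ∑ y, pairTerm V W x y :=
        Finset.sum_congr rfl fun x _ => Finset.sum_filter_of_ne fun y _ hy => by
          by_contra hc
          rw [pairTerm_eq, gradedTrace_eq_zero W (component_eq_bot_of_simple hW hh hc),
            mul_zero] at hy
          exact hy rfl
    _ = _ := Finset.sum_filter_of_ne fun x _ hx => by
          by_contra hc
          refine hx (Finset.sum_eq_zero fun y _ => ?_)
          rw [pairTerm_eq, gradedTrace_eq_zero V (component_eq_bot_of_simple hV hg hc), zero_mul]

/-! ### Reduction to a single sum -/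

open scoped Classical in
/-- By invariance under simultaneous conjugation the inner sum does not depend on `y ∈ h̄`. -/
theorem sum_pairTerm_eq (V W : ZVect ω) (g h : G) :
    ∑ x with IsConj g x, ∑ y with IsConj h y, pairTerm V W x y =
      ((conjugatesOf h).ncard : ℂ) * ∑ x with IsConj g x, pairTerm V W x h := by
  have hc : (conjugatesOf h).ncard = (Finset.univ.filter fun y => IsConj h y).card := by
    rw [← Set.ncard_coe_finset]
    congr 1
    ext y
    rw [Finset.coe_filter_univ]
    rfl
  rw [Finset.sum_comm, hc, ← nsmul_eq_mul]
  refine Finset.sum_eq_card_nsmul fun y hy => ?_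
  obtain ⟨q, rfl⟩ := isConj_iff.1 (Finset.mem_filter.1 hy).2
  refine (Finset.sum_equiv (MulAut.conj q).toEquiv (fun x => ?_) fun x _ => ?_).symm
  · have hx : IsConj x (q * x * q⁻¹) := isConj_iff.2 ⟨q, rfl⟩
    simpa using (⟨fun h => h.trans hx, fun h => h.trans hx.symm⟩ :
      IsConj g x ↔ IsConj g (q * x * q⁻¹))
  · exact (pairTerm_hit V W q x h).symm

end ZVect

section cosets

variable {G : Type*} [Group G]

theorem hit_eq_hit_iff {g p q : G} :
    hit p g = hit q g ↔
      (p : G ⧸ Subgroup.centralizer {g}) = (q : G ⧸ Subgroup.centralizer {g}) := by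
  rw [QuotientGroup.eq, Subgroup.mem_centralizer_singleton_iff, hit, hit]
  constructor <;> intro h
  · calc p⁻¹ * q * g = p⁻¹ * (q * g * q⁻¹) * q := by group
      _ = p⁻¹ * (p * g * p⁻¹) * q := by rw [h]
      _ = g * (p⁻¹ * q) := by group
  · calc p * g * p⁻¹ = p * (g * (p⁻¹ * q)) * q⁻¹ := by group
      _ = p * (p⁻¹ * q * g) * q⁻¹ := by rw [h]
      _ = q * g * q⁻¹ := by group

theorem sum_representatives [Fintype G] {M : Type*} [AddCommMonoid M] (g : G)
    [DecidablePred (IsConj g)] [Fintype (G ⧸ Subgroup.centralizer {g})] (f : G → M)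
    (r : G ⧸ Subgroup.centralizer {g} → G)
    (hr : ∀ q, (r q : G ⧸ Subgroup.centralizer {g}) = q) :
    ∑ q : G ⧸ Subgroup.centralizer {g}, f (hit (r q) g) = ∑ x with IsConj g x, f x := by
  refine Finset.sum_bij (fun q _ => hit (r q) g) (fun q _ => ?_) (fun q _ q' _ e => ?_)
    (fun x hx => ?_) fun _ _ => rfl
  · exact Finset.mem_filter.2 ⟨Finset.mem_univ _, isConj_iff.2 ⟨r q, rfl⟩⟩
  · rw [← hr q, ← hr q']
    exact hit_eq_hit_iff.1 e
  · obtain ⟨p, rfl⟩ := isConj_iff.1 (Finset.mem_filter.1 hx).2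
    exact ⟨(p : G ⧸ Subgroup.centralizer {g}), Finset.mem_univ _, hit_eq_hit_iff.2 (hr _)⟩

/-- Every element of the conjugacy class of `g` is `p ▹ g` for exactly `|C_G(g)|` elements `p`. -/
theorem sum_hit [Fintype G] {M : Type*} [AddCommMonoid M] (g : G) [DecidablePred (IsConj g)]
    (f : G → M) :
    ∑ p, f (hit p g) = Nat.card (Subgroup.centralizer {g}) • ∑ x with IsConj g x, f x := by
  classical
  have hr : ∀ q : G ⧸ Subgroup.centralizer {g},
      ((q.out : G) : G ⧸ Subgroup.centralizer {g}) = q := fun q => QuotientGroup.out_eq' q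
  rw [← sum_representatives g f Quotient.out hr, Finset.smul_sum,
    ← Finset.sum_fiberwise Finset.univ
      (fun p : G => (p : G ⧸ Subgroup.centralizer {g})) fun p => f (hit p g)]
  refine Finset.sum_congr rfl fun q _ => ?_
  have hcard : (Finset.univ.filter
      fun p : G => (p : G ⧸ Subgroup.centralizer {g}) = q).card =
        Nat.card (Subgroup.centralizer {g}) := by
    have h := QuotientGroup.card_preimage_mk (Subgroup.centralizer {g}) {q}
    rw [Nat.card_unique (α := ({q} : Set (G ⧸ Subgroup.centralizer {g}))), mul_one] at h
    rw [← h, ← Set.ncard_coe_finset]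
    congr 1
    ext p
    simp
  rw [← hcard]
  refine Finset.sum_eq_card_nsmul fun p hp => ?_
  congr 1
  exact hit_eq_hit_iff.2 ((Finset.mem_filter.1 hp).2.trans (hr q).symm)

end cosets

end

open scoped Classical in
theorem mainTheorem8 {G : Type*} [Group G] [Fintype G] [DecidableEq G] (ω : ThreeCocycle G)
    (V W : ZVect ω) (g h : G)
    (χ₁ : Subgroup.centralizer {g} → ℂ) (χ₂ : Subgroup.centralizer {h} → ℂ)
    (hV : V.IsSimpleWith g χ₁) (hW : W.IsSimpleWith h χ₂) :
    -- the double sum over both conjugacy classes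
    V.S W = ∑ x with IsConj g x, ∑ y with IsConj h y, pairTerm V W x y ∧
    -- the single sum over `G / C_G(g)`, for every choice of coset representatives
    (∀ r : G ⧸ Subgroup.centralizer {g} → G, (∀ q, (r q : G ⧸ Subgroup.centralizer {g}) = q) →
      V.S W = ((conjugatesOf h).ncard : ℂ) *
        ∑ q : G ⧸ Subgroup.centralizer {g}, sTerm ω g h χ₁ χ₂ (r q)) ∧
    -- the single sum over the conjugacy class of `g`, for every choice of `p` with `p ▹ g = x`
    (∀ r : G → G, (∀ x, IsConj g x → hit (r x) g = x) →
      V.S W = ((conjugatesOf h).ncard : ℂ) *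
        ∑ x with IsConj g x, sTerm ω g h χ₁ χ₂ (r x)) ∧
    -- the single sum over the group
    V.S W = ((conjugatesOf h).ncard : ℂ) / (Nat.card (Subgroup.centralizer {g}) : ℂ) *
      ∑ p : G, sTerm ω g h χ₁ χ₂ p := by
  obtain ⟨hVs, hVg, rfl⟩ := hV
  obtain ⟨hWs, hWh, rfl⟩ := hW
  have hdouble := ZVect.S_eq_sum_isConj hVs hWs hVg hWh
  have hsingle := hdouble.trans (ZVect.sum_pairTerm_eq V W g h)
  simp only [ZVect.sTerm_eq_pairTerm]
  refine ⟨hdouble, fun r hr => ?_, fun r hr => ?_, ?_⟩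
  · rw [hsingle, sum_representatives g (fun x => pairTerm V W x h) r hr]
  · rw [hsingle]
    congr 1
    exact Finset.sum_congr rfl fun x hx => by rw [hr x (Finset.mem_filter.1 hx).2]
  · have hC : (Nat.card (Subgroup.centralizer {g}) : ℂ) ≠ 0 :=
      Nat.cast_ne_zero.2 Nat.card_pos.ne'
    rw [hsingle, sum_hit g fun x => pairTerm V W x h, nsmul_eq_mul]
    field_simp
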